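/- Let $d_1,\dots,d_r$ be natural numbers with greatest common divisor $1$, let $R=\mathbb R[t^{d_1},\dots,t^{d_r}]\subseteq\mathbb R[t]$, and for $n\ge 0$ let $R_{\le n}$ be the real vector space of all polynomials in $R$ of degree at most $n$. Let $\mathfrak c$ be the conductor of $R$, i.e. the least integer $c\ge 0$ such that $t^n\in R$ for all $n\ge c$, and let $D_{\mathfrak c}$ be the Descartes number, i.e. the maximal number of different real zeros of a nonzero polynomial in $R_{\le\mathfrak c}$. A linear functional $L:R_{\le 2k}\to\mathbb R$ is called a moment functional if there is a (positive) Borel measure $\mu$ on $\mathbb R$ such that every $f\in R_{\le 2k}$ is $\mu$-integrable and $L(f)=\int f\,d\mu$ for all $f\in R_{\le 2k}$; the point evaluation at $x\in\mathbb R$ is the functional $l_x(f)=f(x)$. Let $k\ge\mathfrak c$. Then every moment functional $L:R_{\le 2k}\to\mathbb R$ is a conic combination (a linear combination with nonnegative coefficients) of at most $$k+1-\left\lceil\frac{\mathfrak c-D_{\mathfrak c}-1}{2}\right\rceil$$ point evaluations. Moreover, there is a moment functional $L:R_{\le 2k}\to\mathbb R$ that is not a conic combination of fewer than $k-(\mathfrak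 c-D_{\mathfrak c})$ point evaluations. -/

import Mathlib

noncomputable section

open Polynomial MeasureTheory

namespace SparseMoment

/-- The ring `R = ℝ[t^{d₁}, …, t^{d_r}]` as a subalgebra of `ℝ[t]`. -/
def gapRing {r : ℕ} (d : Fin r → ℕ) : Subalgebra ℝ ℝ[X] :=
  Algebra.adjoin ℝ (Set.range fun i => (X : ℝ[X]) ^ d i)

/-- The vector space `R_{≤ n}` of the polynomials in `R` of degree at most `n`. -/
def gapRingLE {r : ℕ} (d : Fin r → ℕ) (n : ℕ) : Submodule ℝ ℝ[X] :=
  Subalgebra.toSubmodule (gapRing d) ⊓ degreeLE ℝ (n : WithBot ℕ)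

/-- The conductor of `R`: the least `c` such that `t ^ n ∈ R` for all `n ≥ c`. -/
def conductor {r : ℕ} (d : Fin r → ℕ) : ℕ :=
  sInf {c : ℕ | ∀ n : ℕ, c ≤ n → (X : ℝ[X]) ^ n ∈ gapRing d}

/-- The `k`-th Descartes number of `R`: the maximal number of different real zeros of a
nonzero polynomial in `R_{≤ k}`. -/
def descartesNumber {r : ℕ} (d : Fin r → ℕ) (k : ℕ) : ℕ :=
  sSup {N : ℕ | ∃ f ∈ gapRingLE d k, f ≠ 0 ∧ {x : ℝ | f.eval x = 0}.ncard = N}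

/-- The point evaluation `l_x : V → ℝ`, `f ↦ f(x)`, on a space `V` of polynomials. -/
def pointEval (V : Submodule ℝ ℝ[X]) (x : ℝ) : V →ₗ[ℝ] ℝ :=
  (Polynomial.leval x).comp V.subtype

/-- `L` is a moment functional: it is integration against some positive Borel measure on `ℝ`
for which all elements of `V` are integrable. -/
def IsMomentFunctional {V : Submodule ℝ ℝ[X]} (L : V →ₗ[ℝ] ℝ) : Prop :=
  ∃ μ : Measure ℝ, ∀ f : V, Integrable (fun x : ℝ => (f : ℝ[X]).eval x) μ ∧
    L f = ∫ x, (f : ℝ[X]).eval x ∂μ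

/-- `L` is a conic combination of `n` point evaluations. Coefficients may vanish and points may
repeat, so this is the same as being a conic combination of at most `n` point evaluations. -/
def IsConicCombination {V : Submodule ℝ ℝ[X]} (L : V →ₗ[ℝ] ℝ) (n : ℕ) : Prop :=
  ∃ (x : Fin n → ℝ) (a : Fin n → ℝ), (∀ i, 0 ≤ a i) ∧ L = ∑ i, a i • pointEval V (x i)

/-- For coprime exponents the minimum defining the conductor is attained. -/
theorem conductor_isLeast {r : ℕ} (d : Fin r → ℕ) (hd : Finset.univ.gcd d = 1) :
    IsLeast {c : ℕ | ∀ n : ℕ, c ≤ n → (X : ℝ[X]) ^ n ∈ gapRing d} (conductor d) := by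
  have hne : {c : ℕ | ∀ n : ℕ, c ≤ n → (X : ℝ[X]) ^ n ∈ gapRing d}.Nonempty := by
    obtain ⟨c, hc⟩ := Nat.exists_mem_closure_of_ge (Set.range d)
    refine ⟨c, fun n hn => ?_⟩
    have h1 : Nat.setGcd (Set.range d) = 1 := by
      apply Nat.dvd_one.mp
      rw [← hd]
      exact Finset.dvd_gcd fun i _ => Nat.setGcd_dvd_of_mem ⟨i, rfl⟩
    have h2 := hc n hn (by rw [h1]; exact one_dvd n)
    clear hn
    induction h2 using AddSubmonoid.closure_induction with
    | mem x hx =>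
      obtain ⟨i, rfl⟩ := hx
      exact Algebra.subset_adjoin ⟨i, rfl⟩
    | zero => simp
    | add x y _ _ hx hy => rw [pow_add]; exact (gapRing d).mul_mem hx hy
  exact ⟨Nat.sInf_mem hne, fun c hc => Nat.sInf_le hc⟩

/-- The maximum defining the Descartes number is attained. -/
theorem descartesNumber_isGreatest {r : ℕ} (d : Fin r → ℕ) (k : ℕ) :
    IsGreatest {N : ℕ | ∃ f ∈ gapRingLE d k, f ≠ 0 ∧ {x : ℝ | f.eval x = 0}.ncard = N}
      (descartesNumber d k) := by
  have hb : BddAbove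
      {N : ℕ | ∃ f ∈ gapRingLE d k, f ≠ 0 ∧ {x : ℝ | f.eval x = 0}.ncard = N} := by
    refine ⟨k, ?_⟩
    rintro N ⟨f, hf, hf0, rfl⟩
    have h1 : {x : ℝ | f.eval x = 0} = (f.roots.toFinset : Set ℝ) := by
      ext x; simp [hf0]
    rw [h1, Set.ncard_coe_finset]
    exact (Multiset.toFinset_card_le _).trans ((card_roots' f).trans
      (natDegree_le_of_degree_le (mem_degreeLE.mp hf.2)))
  refine ⟨Nat.sSup_mem ⟨_, 1, ⟨(gapRing d).one_mem, ?_⟩, one_ne_zero, rfl⟩ hb,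
    fun N hN => le_csSup hb hN⟩
  exact mem_degreeLE.mpr (degree_one_le.trans (by exact_mod_cast Nat.zero_le k))

end SparseMoment

end

noncomputable section

open Polynomial MeasureTheory

namespace SparseMoment

/-! ### Monomial structure of `R`. -/

variable {r : ℕ} {d : Fin r → ℕ}

/-! Write c for the conductor and D for the Descartes number of degree c.

Upper bound. If L kills a nonzero nonnegative f, a representing measure lives on the zeros Z of f,
and L is a conic combination of evaluations on Z. Lowering f by a small constant splits each zero in
two, and a nonzero element of `R` of degree at most 2k has at most D + (2k - c) + 1 zeros
(`card_roots_le_descartesNumber_add`), so 2|Z| is at most this number. If L is strictly positive on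
the nonzero nonnegative polynomials, subtract from it the largest multiple of an evaluation at x
that keeps it nonnegative on them. The difference kills some nonnegative f, and the previous count
applies at the price of one more point. The difference is not known to have a measure: mass may sit
at infinity. Taking x far out forces f to have degree exactly 2k, which rules this out
(`exists_nonneg_add_mul`).

Lower bound. Some p in `R` of degree at most k has at least D + (k - c) zeros
(`exists_card_roots_ge`). Let L be the sum of the evaluations at all zeros of p. Since L(p²) = 0,
every representation uses only zeros of p, and independence of these evaluations (`exists_dual`)
forces all of them to occur. -/

theorem X_pow_mem_gapRing_of_coeff_ne_zero {f : ℝ[X]} (hf : f ∈ gapRing d) :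
    ∀ i, f.coeff i ≠ 0 → (X : ℝ[X]) ^ i ∈ gapRing d := by
  unfold gapRing at hf
  induction hf using Algebra.adjoin_induction with
  | mem f hf =>
    obtain ⟨j, rfl⟩ := hf
    intro i hi
    have : i = d j := by
      by_contra h
      exact hi (by simp [coeff_X_pow, h])
    rw [this]
    exact Algebra.subset_adjoin ⟨j, rfl⟩
  | algebraMap a =>
    intro i hi
    have : i = 0 := by
      by_contra h
      exact hi (by rw [algebraMap_eq, coeff_C, if_neg h])
    rw [this, pow_zero]
    exact one_mem _
  | add f g _ _ hf hg =>
    intro i hi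
    by_cases h : f.coeff i = 0
    · exact hg i fun h' => hi (by rw [coeff_add, h, h', add_zero])
    · exact hf i h
  | mul f g _ _ hf hg =>
    intro i hi
    rw [coeff_mul] at hi
    obtain ⟨⟨a, b⟩, hab, hne⟩ := Finset.exists_ne_zero_of_sum_ne_zero hi
    rw [← Finset.HasAntidiagonal.mem_antidiagonal.mp hab, pow_add]
    exact mul_mem (hf a (left_ne_zero_of_mul hne)) (hg b (right_ne_zero_of_mul hne))

/-- `R` is spanned by the monomials it contains, so rescaling the coefficients of an element of `R`
one by one stays in `R`. -/
theorem mem_gapRing_iff {f : ℝ[X]} :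
    f ∈ gapRing d ↔ ∀ i, f.coeff i ≠ 0 → (X : ℝ[X]) ^ i ∈ gapRing d := by
  refine ⟨X_pow_mem_gapRing_of_coeff_ne_zero, fun h => ?_⟩
  rw [f.as_sum_support_C_mul_X_pow]
  refine sum_mem fun i hi => ?_
  rw [← smul_eq_C_mul]
  exact (gapRing d).smul_mem (h i (mem_support_iff.mp hi)) _

theorem mem_gapRingLE_iff {n : ℕ} {f : ℝ[X]} :
    f ∈ gapRingLE d n ↔ f ∈ gapRing d ∧ f.natDegree ≤ n := by
  rw [gapRingLE, Submodule.mem_inf, mem_degreeLE, natDegree_le_iff_degree_le]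
  rfl

theorem one_mem_gapRingLE (n : ℕ) : (1 : ℝ[X]) ∈ gapRingLE d n :=
  mem_gapRingLE_iff.mpr ⟨one_mem _, by simp⟩

theorem X_pow_mem_gapRing (hd : Finset.univ.gcd d = 1) {n : ℕ} (hn : conductor d ≤ n) :
    (X : ℝ[X]) ^ n ∈ gapRing d :=
  (conductor_isLeast d hd).1 n hn

theorem X_pow_mul_mem_gapRing (hd : Finset.univ.gcd d = 1) {n : ℕ} (hn : conductor d ≤ n)
    (q : ℝ[X]) : X ^ n * q ∈ gapRing d := by
  refine mem_gapRing_iff.mpr fun i hi => X_pow_mem_gapRing hd (hn.trans ?_)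
  by_contra h
  exact hi (by rw [coeff_X_pow_mul', if_neg h])

theorem setOf_eval_eq_zero {f : ℝ[X]} (hf : f ≠ 0) :
    {x : ℝ | f.eval x = 0} = (f.roots.toFinset : Set ℝ) := by
  ext x; simp [hf]

theorem card_roots_le_descartesNumber {n : ℕ} {f : ℝ[X]} (hf : f ∈ gapRingLE d n) (h0 : f ≠ 0) :
    f.roots.toFinset.card ≤ descartesNumber d n :=
  (descartesNumber_isGreatest d n).2
    ⟨f, hf, h0, by rw [setOf_eval_eq_zero h0, Set.ncard_coe_finset]⟩

theorem exists_card_roots_eq_descartesNumber (d : Fin r → ℕ) (n : ℕ) :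
    ∃ f ∈ gapRingLE d n, f ≠ 0 ∧ f.roots.toFinset.card = descartesNumber d n := by
  obtain ⟨f, hf, h0, h⟩ := (descartesNumber_isGreatest d n).1
  exact ⟨f, hf, h0, by rw [← h, setOf_eval_eq_zero h0, Set.ncard_coe_finset]⟩

/-! ### Zero counts by reversal and Rolle's theorem. -/

theorem card_roots_erase_zero_le_reflect {p : ℝ[X]} {N : ℕ} (hp : p ≠ 0) (hN : p.natDegree ≤ N) :
    (p.roots.toFinset.erase 0).card ≤ ((reflect N p).roots.toFinset.erase 0).card := by
  refine Finset.card_le_card_of_injOn (fun x => x⁻¹) (fun x hx => ?_) inv_injective.injOn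
  simp only [Finset.coe_erase, Set.mem_sdiff, Finset.mem_coe, Multiset.mem_toFinset, mem_roots',
    Set.mem_singleton_iff, IsRoot.def] at hx
  obtain ⟨⟨-, hx⟩, hx0⟩ := hx
  have : Invertible x := invertibleOfNonzero hx0
  have h := (eval₂_reflect_eq_zero_iff (RingHom.id ℝ) x N p hN).mpr hx
  simp only [Finset.coe_erase, Set.mem_sdiff, Finset.mem_coe, Multiset.mem_toFinset, mem_roots',
    Set.mem_singleton_iff, IsRoot.def, ne_eq, reflect_eq_zero_iff]
  exact ⟨⟨hp, by rwa [invOf_eq_inv] at h⟩, inv_ne_zero hx0⟩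

theorem card_roots_le_iterate_derivative (p : ℝ[X]) (j : ℕ) :
    p.roots.toFinset.card ≤ (derivative^[j] p).roots.toFinset.card + j := by
  induction j with
  | zero => simp
  | succ j ih =>
    rw [Function.iterate_succ_apply']
    have := card_roots_toFinset_le_derivative (derivative^[j] p)
    omega

/-- The zeros of a polynomial in `R_{≤ n}` are bounded by the Descartes number of a smaller degree:
pass to the reciprocal polynomial, differentiate `n - c` times, and pass back. -/
theorem card_roots_le_descartesNumber_add {c n : ℕ} (hcn : c ≤ n) {f : ℝ[X]}
    (hf : f ∈ gapRingLE d n) (h0 : f ≠ 0) :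
    f.roots.toFinset.card ≤ descartesNumber d c + (n - c) + 1 := by
  obtain ⟨hfR, hfn⟩ := mem_gapRingLE_iff.mp hf
  obtain ⟨j, rfl⟩ := Nat.exists_eq_add_of_le hcn
  rw [Nat.add_sub_cancel_left]
  set h := reflect (c + j) f with hh
  set g := reflect c (derivative^[j] h) with hg
  -- Differentiating between two reversals moves no exponent: it only rescales coefficients, by
  -- positive factors up to degree c, and kills those above c.
  have hcoeff : ∀ i, g.coeff i =
      if i ≤ c then ((c + j - i).descFactorial j : ℝ) * f.coeff i else 0 := by
    intro i
    rw [hg, coeff_reflect, coeff_iterate_derivative, hh, coeff_reflect, nsmul_eq_mul]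
    split_ifs with hi
    · rw [revAt_le hi, show c - i + j = c + j - i by omega, revAt_le (by omega),
        show c + j - (c + j - i) = i by omega]
    · rw [revAt_eq_self_of_lt (by omega), revAt_eq_self_of_lt (by omega),
        coeff_eq_zero_of_natDegree_lt (by omega), mul_zero]
  -- If nothing survives, `f` is `X ^ (c + 1)` times a factor of degree less than `j`, which has few
  -- enough zeros.
  by_cases hg0 : g = 0
  · have hdvd : X ^ (c + 1) ∣ f := by
      refine X_pow_dvd_iff.mpr fun i hi => ?_
      have h1 := hcoeff i
      rw [hg0, coeff_zero, if_pos (by omega)] at h1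
      refine (mul_eq_zero.mp h1.symm).resolve_left ?_
      exact_mod_cast (Nat.descFactorial_pos.mpr (by omega)).ne'
    obtain ⟨q, rfl⟩ := hdvd
    have hq : q ≠ 0 := right_ne_zero_of_mul h0
    rw [natDegree_X_pow_mul _ hq] at hfn
    have hsub : (X ^ (c + 1) * q).roots.toFinset ⊆ insert 0 q.roots.toFinset := by
      intro x hx
      have hx := (mem_roots'.mp (Multiset.mem_toFinset.mp hx)).2
      rw [IsRoot.def, eval_mul, eval_pow, eval_X, mul_eq_zero] at hx
      rw [Finset.mem_insert, Multiset.mem_toFinset, mem_roots hq]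
      exact hx.imp (fun h => by simpa using h) id
    have h1 := (Finset.card_le_card hsub).trans (Finset.card_insert_le _ _)
    have h2 := (Multiset.toFinset_card_le q.roots).trans (card_roots' q)
    omega
  · have hgmem : g ∈ gapRingLE d c := by
      refine mem_gapRingLE_iff.mpr ⟨mem_gapRing_iff.mpr fun i hi => ?_, ?_⟩
      · refine mem_gapRing_iff.mp hfR i fun h' => hi ?_
        rw [hcoeff, h', mul_zero, ite_self]
      · refine natDegree_le_iff_coeff_eq_zero.mpr fun i hi => ?_
        rw [hcoeff, if_neg (by omega)]
    have hD := card_roots_le_descartesNumber hgmem hg0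
    have hh0 : h ≠ 0 := by rwa [hh, ne_eq, reflect_eq_zero_iff]
    have hk0 : derivative^[j] h ≠ 0 := fun h' => hg0 (by rw [hg, h', reflect_zero])
    have hhn : h.natDegree ≤ c + j := by
      have := natDegree_reflect_le (N := c + j) (p := f)
      rw [← hh] at this
      omega
    have hkn : (derivative^[j] h).natDegree ≤ c := by
      have := natDegree_iterate_derivative h j
      omega
    have h1 := card_roots_erase_zero_le_reflect h0 hfn
    have h2 := card_roots_erase_zero_le_reflect hk0 hkn
    rw [← hh] at h1
    rw [← hg] at h2
    have h3 := card_roots_le_iterate_derivative h j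
    have h4 := Finset.card_erase_le (s := h.roots.toFinset) (a := 0)
    have h5 := Finset.pred_card_le_card_erase (s := (derivative^[j] h).roots.toFinset) (a := 0)
    -- Reversal only transports nonzero roots. A root 0 of the derivative has no counterpart in `g`,
    -- which costs the extra 1. A root 0 of `f` is also a root of `g`, so it adds one to both sides.
    by_cases hz : (0 : ℝ) ∈ f.roots.toFinset
    · have hz' : (0 : ℝ) ∈ g.roots.toFinset := by
        have := (mem_roots'.mp (Multiset.mem_toFinset.mp hz)).2
        rw [IsRoot.def, ← coeff_zero_eq_eval_zero] at this
        rw [Multiset.mem_toFinset, mem_roots hg0, IsRoot.def, ← coeff_zero_eq_eval_zero, hcoeff,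
          this, mul_zero, ite_self]
      have h6 := Finset.card_erase_add_one hz
      have h7 := Finset.card_erase_add_one hz'
      omega
    · rw [Finset.erase_eq_of_notMem hz] at h1
      have h7 := Finset.card_erase_le (s := g.roots.toFinset) (a := 0)
      omega

/-! ### Sign changes and polynomials with many zeros. -/

/-- The number of sign changes of `g` along the points `a 0, …, a M`. -/
def signChanges (g : ℝ[X]) (a : ℕ → ℝ) (M : ℕ) : ℕ :=
  ((Finset.range M).filter fun i => g.eval (a i) * g.eval (a (i + 1)) < 0).card

theorem signChanges_le_card_roots {g : ℝ[X]} (hg : g ≠ 0) {a : ℕ → ℝ} (ha : StrictMono a) (M : ℕ) :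
    signChanges g a M ≤ g.roots.toFinset.card := by
  have key : ∀ i, g.eval (a i) * g.eval (a (i + 1)) < 0 →
      ∃ x, a i < x ∧ x < a (i + 1) ∧ g.eval x = 0 := by
    intro i hi
    have hlt := ha (Nat.lt_succ_self i)
    have hc : ContinuousOn (fun x => g.eval x) (Set.Icc (a i) (a (i + 1))) :=
      g.continuous.continuousOn
    rcases mul_neg_iff.mp hi with ⟨h1, h2⟩ | ⟨h1, h2⟩
    · obtain ⟨x, hx, hx0⟩ := intermediate_value_Ioo' hlt.le hc ⟨h2, h1⟩
      exact ⟨x, hx.1, hx.2, hx0⟩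
    · obtain ⟨x, hx, hx0⟩ := intermediate_value_Ioo hlt.le hc ⟨h1, h2⟩
      exact ⟨x, hx.1, hx.2, hx0⟩
  choose! x hx using key
  have hlt : ∀ i j, g.eval (a i) * g.eval (a (i + 1)) < 0 → g.eval (a j) * g.eval (a (j + 1)) < 0 →
      i < j → x i < x j := fun i j hi hj hij =>
    (hx i hi).2.1.trans_le ((ha.monotone hij).trans (hx j hj).1.le)
  refine Finset.card_le_card_of_injOn x (fun i hi => ?_) fun i hi j hj hij => ?_
  · have hi := (Finset.mem_filter.mp hi).2
    simpa [hg] using (hx i hi).2.2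
  · have hi := (Finset.mem_filter.mp hi).2
    have hj := (Finset.mem_filter.mp hj).2
    rcases lt_trichotomy i j with h | h | h
    · exact absurd hij (hlt i j hi hj h).ne
    · exact h
    · exact absurd hij (hlt j i hj hi h).ne'

theorem exists_strictMono_mem (s : Finset ℝ) :
    ∃ z : ℕ → ℝ, StrictMono z ∧ ∀ i < s.card, z i ∈ s := by
  induction s using Finset.induction_on_max with
  | empty => exact ⟨fun i => i, Nat.strictMono_cast, by simp⟩
  | insert x s hx ih =>
    obtain ⟨z, hz, hzs⟩ := ih
    -- Beyond the set the sequence continues in unit steps, only to be strictly monotone on all of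
    -- ℕ.
    refine ⟨fun i => if i < s.card then z i else x + ((i : ℝ) - s.card),
      strictMono_nat_of_lt_succ fun i => ?_, fun i hi => ?_⟩
    · rcases lt_trichotomy (i + 1) s.card with h | h | h
      · simp only [if_pos h, if_pos (Nat.lt_of_succ_lt h)]
        exact hz (Nat.lt_succ_self i)
      · rw [if_pos (by omega), if_neg (by omega), ← h, sub_self, add_zero]
        exact hx _ (hzs i (by omega))
      · rw [if_neg (by omega), if_neg (by omega)]
        push_cast
        linarith
    · rw [Finset.card_insert_of_notMem fun h => (hx x h).false] at hi
      by_cases h : i < s.card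
      · simp only [if_pos h]
        exact Finset.mem_insert_of_mem (hzs i h)
      · have : i = s.card := by omega
        subst this
        simp

/-- Points `a 0 < a 1 < …` such that the zeros of `f` are interlaced with points where `f` does not
vanish. -/
theorem exists_interlacing {f : ℝ[X]} (hf : f ≠ 0) :
    ∃ a : ℕ → ℝ, StrictMono a ∧ (∀ i < f.roots.toFinset.card, f.eval (a (2 * i + 1)) = 0) ∧
      ∀ i, f.eval (a (2 * i)) ≠ 0 := by
  obtain ⟨z, hz, hzs⟩ := exists_strictMono_mem f.roots.toFinset
  have hw : ∀ i : ℕ, ∃ w, (if i = 0 then z 0 - 1 else z (i - 1)) < w ∧ w < z i ∧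
      f.eval w ≠ 0 := by
    intro i
    have hlt : (if i = 0 then z 0 - 1 else z (i - 1)) < z i := by
      split_ifs with h
      · rw [h]; linarith
      · exact hz (by omega)
    obtain ⟨w, hw, hwr⟩ := (Set.Ioo_infinite hlt).exists_notMem_finset f.roots.toFinset
    exact ⟨w, hw.1, hw.2, by simpa [hf] using hwr⟩
  choose w hw1 hw2 hw3 using hw
  refine ⟨fun n => if n % 2 = 0 then w (n / 2) else z (n / 2),
    strictMono_nat_of_lt_succ fun n => ?_, fun i hi => ?_, fun i => ?_⟩
  · rcases Nat.even_or_odd' n with ⟨i, rfl | rfl⟩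
    · simp only [show (2 * i) % 2 = 0 by omega, show (2 * i + 1) % 2 = 1 by omega,
        show 2 * i / 2 = i by omega, show (2 * i + 1) / 2 = i by omega, if_true, one_ne_zero,
        if_false]
      exact hw2 i
    · simp only [show (2 * i + 1) % 2 = 1 by omega, show (2 * i + 1 + 1) % 2 = 0 by omega,
        show (2 * i + 1) / 2 = i by omega, show (2 * i + 1 + 1) / 2 = i + 1 by omega, if_true,
        one_ne_zero, if_false]
      simpa using hw1 (i + 1)
  · simp only [show (2 * i + 1) % 2 = 1 by omega, show (2 * i + 1) / 2 = i by omega, one_ne_zero,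
      if_false]
    have := hzs i hi
    simpa [hf] using this
  · simpa [show 2 * i / 2 = i by omega] using hw3 i

/-- Small perturbations of `f` keep its signs at finitely many points. -/
theorem exists_pos_perturbation (f q : ℝ[X]) (a : ℕ → ℝ) (M : ℕ) :
    ∃ ε > 0, ∀ i ≤ M, f.eval (a i) ≠ 0 → 0 < f.eval (a i) * (f + C ε * q).eval (a i) := by
  have h : ∀ᶠ ε : ℝ in nhdsWithin 0 (Set.Ioi 0), ∀ i ∈ Finset.range (M + 1), f.eval (a i) ≠ 0 →
      0 < f.eval (a i) * (f + C ε * q).eval (a i) := by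
    refine (Filter.eventually_all_finset _).mpr fun i _ => ?_
    by_cases h0 : f.eval (a i) = 0
    · exact Filter.Eventually.of_forall fun _ h => absurd h0 h
    · have hc : Continuous fun ε : ℝ => f.eval (a i) * (f + C ε * q).eval (a i) := by
        simp only [eval_add, eval_mul, eval_C]
        fun_prop
      have := (hc.tendsto 0).eventually_const_lt
        (show 0 < f.eval (a i) * (f + C 0 * q).eval (a i) by
          simpa using mul_self_pos.mpr h0)
      exact (this.filter_mono nhdsWithin_le_nhds).mono fun _ h _ => h
  obtain ⟨ε, hε, hpos⟩ := (h.and self_mem_nhdsWithin).exists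
  exact ⟨ε, hpos, fun i hi => hε i (Finset.mem_range.mpr (by omega))⟩

theorem sum_range_two_mul (F : ℕ → ℕ) (N : ℕ) :
    ∑ j ∈ Finset.range (2 * N), F j = ∑ i ∈ Finset.range N, (F (2 * i) + F (2 * i + 1)) := by
  induction N with
  | zero => simp
  | succ N ih =>
    rw [show 2 * (N + 1) = 2 * N + 1 + 1 by ring, Finset.sum_range_succ, Finset.sum_range_succ,
      Finset.sum_range_succ, ih, add_assoc]

/-- Adding a small constant of the sign of `τ` resolves the zeros of `f`. -/
theorem exists_le_signChanges_add_const {f : ℝ[X]} {a : ℕ → ℝ} {N : ℕ}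
    (hz : ∀ i < N, f.eval (a (2 * i + 1)) = 0) (hw : ∀ i, f.eval (a (2 * i)) ≠ 0)
    (τ : ℝ) :
    ∃ ε > 0, (f + C ε * C τ).eval (a (2 * N)) ≠ 0 ∧
      ∑ i ∈ Finset.range N, ((if τ * f.eval (a (2 * i)) < 0 then 1 else 0) +
        (if τ * f.eval (a (2 * (i + 1))) < 0 then 1 else 0)) ≤
      signChanges (f + C ε * C τ) a (2 * N) := by
  obtain ⟨ε, hε, h⟩ := exists_pos_perturbation f (C τ) a (2 * N)
  refine ⟨ε, hε, right_ne_zero_of_mul (h _ le_rfl (hw N)).ne', ?_⟩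
  have key : ∀ i ≤ N, τ * f.eval (a (2 * i)) < 0 →
      (ε * τ) * (f + C ε * C τ).eval (a (2 * i)) < 0 := by
    intro i hi hneg
    have h1 := h (2 * i) (by omega) (hw i)
    rw [mul_assoc]
    refine mul_neg_of_pos_of_neg hε ?_
    rcases mul_neg_iff.mp hneg with ⟨h2, h3⟩ | ⟨h2, h3⟩
    · exact mul_neg_of_pos_of_neg h2 (neg_of_mul_pos_right h1 h3.le)
    · exact mul_neg_of_neg_of_pos h2 (pos_of_mul_pos_right h1 h3.le)
  rw [signChanges, Finset.card_filter, sum_range_two_mul]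
  refine Finset.sum_le_sum fun i hi => ?_
  have hi := Finset.mem_range.mp hi
  have hmid : (f + C ε * C τ).eval (a (2 * i + 1)) = ε * τ := by
    simp [hz i hi]
  rw [show 2 * i + 1 + 1 = 2 * (i + 1) by ring, hmid]
  gcongr ?_ + ?_
  · split_ifs with h1 h2 <;> try simp
    exact h2 (by rw [mul_comm]; exact key i hi.le h1)
  · split_ifs with h1 h2 <;> try simp
    exact h2 (key (i + 1) hi h1)

/-- Both neighbours of each zero are positive, so after a small downward shift each zero yields two
sign changes. -/
theorem two_mul_card_roots_le {f : ℝ[X]} (hf : f ≠ 0) (hpos : ∀ x, 0 ≤ f.eval x) :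
    ∃ ε : ℝ, f + C ε ≠ 0 ∧ 2 * f.roots.toFinset.card ≤ (f + C ε).roots.toFinset.card := by
  obtain ⟨a, ha, hz, hw⟩ := exists_interlacing hf
  obtain ⟨ε, -, hne, h⟩ := exists_le_signChanges_add_const hz hw (-1)
  have h0 : f + C ε * C (-1) ≠ 0 := fun h' => hne (by rw [h', eval_zero])
  rw [← C_mul] at h0 h
  refine ⟨ε * -1, h0, le_trans (le_of_eq ?_) (h.trans (signChanges_le_card_roots h0 ha _))⟩
  have : ∀ i, -1 * f.eval (a (2 * i)) < 0 := fun i => by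
    have := (hpos (a (2 * i))).lt_of_ne' (hw i)
    linarith
  simp only [this, if_true, Finset.sum_const, Finset.card_range, smul_eq_mul]
  ring

/-- A polynomial with `N` zeros can be shifted by a constant so that it has `N` sign changes. -/
theorem exists_card_roots_le_signChanges {f : ℝ[X]} (hf : f ≠ 0) :
    ∃ (ε : ℝ) (a : ℕ → ℝ) (M : ℕ), StrictMono a ∧ (f + C ε).eval (a M) ≠ 0 ∧
      f.roots.toFinset.card ≤ signChanges (f + C ε) a M := by
  obtain ⟨a, ha, hz, hw⟩ := exists_interlacing hf
  obtain ⟨ε, -, hne, h⟩ := exists_le_signChanges_add_const hz hw 1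
  obtain ⟨ε', -, hne', h'⟩ := exists_le_signChanges_add_const hz hw (-1)
  rw [← C_mul] at hne hne' h h'
  set N := f.roots.toFinset.card
  -- Raising `f` gains a sign change at each negative neighbour of a zero, lowering it at each
  -- positive one. Together these are 2N, so one of the two shifts gains at least N.
  have hsum : ∑ i ∈ Finset.range N, ((if 1 * f.eval (a (2 * i)) < 0 then 1 else 0) +
        (if 1 * f.eval (a (2 * (i + 1))) < 0 then 1 else 0)) +
      ∑ i ∈ Finset.range N, ((if -1 * f.eval (a (2 * i)) < 0 then 1 else 0) +
        (if -1 * f.eval (a (2 * (i + 1))) < 0 then 1 else 0)) = N * 2 := by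
    rw [← Finset.sum_add_distrib]
    have h1 : ∀ i, (if 1 * f.eval (a (2 * i)) < 0 then 1 else 0) +
        (if -1 * f.eval (a (2 * i)) < 0 then 1 else 0) = 1 := by
      intro i
      rcases (hw i).lt_or_gt with hi | hi
      · rw [if_pos (by linarith), if_neg (by linarith)]
      · rw [if_neg (by linarith), if_pos (by linarith)]
    rw [Finset.sum_congr rfl (g := fun _ => 2), Finset.sum_const, Finset.card_range, smul_eq_mul]
    intro i _
    have := h1 i
    have := h1 (i + 1)
    omega
  by_cases hN : N ≤ signChanges (f + C (ε * 1)) a (2 * N)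
  · exact ⟨_, a, _, ha, hne, hN⟩
  · exact ⟨_, a, _, ha, hne', by omega⟩

/-- A small multiple of a higher power of `X` creates an additional sign change. -/
theorem exists_signChanges_add_X_pow {g : ℝ[X]} {n : ℕ} (hn : g.natDegree ≤ n) {a : ℕ → ℝ}
    (ha : StrictMono a) {M : ℕ} (hM : g.eval (a M) ≠ 0) :
    ∃ (ε : ℝ) (b : ℕ → ℝ), StrictMono b ∧ (g + C ε * X ^ (n + 1)).eval (b (M + 1)) ≠ 0 ∧
      signChanges g a M + 1 ≤ signChanges (g + C ε * X ^ (n + 1)) b (M + 1) := by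
  -- The new leading coefficient has the sign opposite to `g` at the last point, so the sign flips
  -- once more far to the right, at `Y`.
  obtain ⟨ε, hε, h⟩ := exists_pos_perturbation g (C (-g.eval (a M)) * X ^ (n + 1)) a M
  rw [← mul_assoc, ← C_mul] at h
  set σ := ε * -g.eval (a M) with hσ
  have hσ0 : σ ≠ 0 := mul_ne_zero hε.ne' (neg_ne_zero.mpr hM)
  set p := g + C σ * X ^ (n + 1) with hp
  have hdeg : g.degree < (C σ * X ^ (n + 1)).degree := by
    rw [degree_C_mul_X_pow _ hσ0]
    exact (natDegree_le_iff_degree_le.mp hn).trans_lt (by exact_mod_cast Nat.lt_succ_self n)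
  have hlim : Filter.Tendsto (fun x => (C (g.eval (a M)) * p).eval x) Filter.atTop
      Filter.atBot := by
    refine tendsto_atBot_of_leadingCoeff_nonpos _ ?_ ?_
    · rw [degree_C_mul hM, hp, degree_add_eq_right_of_degree_lt hdeg, degree_C_mul_X_pow _ hσ0]
      exact_mod_cast Nat.succ_pos n
    · rw [leadingCoeff_mul, leadingCoeff_C, hp, leadingCoeff_add_of_degree_lt hdeg,
        leadingCoeff_C_mul_X_pow, hσ]
      nlinarith [mul_self_nonneg (g.eval (a M))]
  obtain ⟨Y, hY, hYM⟩ := ((hlim.eventually_lt_atBot 0).and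
    (Filter.eventually_gt_atTop (a M))).exists
  rw [eval_mul, eval_C] at hY
  have hb : ∀ i ≤ M, (if i ≤ M then a i else Y + ((i : ℝ) - (M + 1))) = a i := fun i hi =>
    if_pos hi
  have hb' : (if M + 1 ≤ M then a (M + 1) else Y + (((M + 1 : ℕ) : ℝ) - (M + 1))) = Y := by
    simp
  refine ⟨σ, fun i => if i ≤ M then a i else Y + ((i : ℝ) - (M + 1)),
    strictMono_nat_of_lt_succ fun i => ?_, ?_, ?_⟩
  · rcases lt_trichotomy i M with hi | rfl | hi
    · rw [hb i hi.le, hb (i + 1) hi]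
      exact ha (Nat.lt_succ_self i)
    · rw [hb i le_rfl, hb']
      exact hYM
    · rw [if_neg (by omega), if_neg (by omega)]
      push_cast
      linarith
  · beta_reduce
    rw [hb']
    exact right_ne_zero_of_mul hY.ne
  · rw [signChanges, signChanges, Finset.card_filter, Finset.card_filter, Finset.sum_range_succ,
      hb M le_rfl, hb']
    have hlast : p.eval (a M) * p.eval Y < 0 := by
      have h1 := h M le_rfl hM
      rcases mul_pos_iff.mp h1 with ⟨h2, h3⟩ | ⟨h2, h3⟩
      · exact mul_neg_of_pos_of_neg h3 (by nlinarith)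
      · exact mul_neg_of_neg_of_pos h3 (by nlinarith)
    rw [if_pos hlast]
    gcongr with i hi
    have hi := Finset.mem_range.mp hi
    rw [hb i hi.le, hb (i + 1) hi]
    split_ifs with h1 h2 <;> try simp
    refine h2 ?_
    have h3 := h i hi.le (left_ne_zero_of_mul h1.ne)
    have h4 := h (i + 1) hi (right_ne_zero_of_mul h1.ne)
    have h5 := mul_pos h3 h4
    by_contra h6
    nlinarith [mul_nonneg_of_nonpos_of_nonpos h1.le (neg_nonpos.mpr (not_lt.mp h6))]

/-- From c on every monomial is available, and each one adds a sign change. The induction counts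
sign changes instead of zeros because these survive small perturbations. -/
theorem exists_card_roots_ge (hd : Finset.univ.gcd d = 1) {k : ℕ} (hk : conductor d ≤ k) :
    ∃ p ∈ gapRingLE d k, p ≠ 0 ∧
      descartesNumber d (conductor d) + (k - conductor d) ≤ p.roots.toFinset.card := by
  obtain ⟨j, rfl⟩ := Nat.exists_eq_add_of_le hk
  suffices h : ∃ p ∈ gapRingLE d (conductor d + j), ∃ (a : ℕ → ℝ) (M : ℕ), StrictMono a ∧
      p.eval (a M) ≠ 0 ∧ descartesNumber d (conductor d) + j ≤ signChanges p a M by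
    obtain ⟨p, hp, a, M, ha, hM, h⟩ := h
    have hp0 : p ≠ 0 := fun h' => hM (by rw [h', eval_zero])
    refine ⟨p, hp, hp0, ?_⟩
    rw [Nat.add_sub_cancel_left]
    exact h.trans (signChanges_le_card_roots hp0 ha M)
  clear hk
  induction j with
  | zero =>
    obtain ⟨f, hf, hf0, hcard⟩ := exists_card_roots_eq_descartesNumber d (conductor d)
    obtain ⟨ε, a, M, ha, hM, h⟩ := exists_card_roots_le_signChanges hf0
    refine ⟨f + C ε, add_mem hf ?_, a, M, ha, hM, by omega⟩
    rw [← mul_one (C ε), ← smul_eq_C_mul]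
    exact Submodule.smul_mem _ _ (one_mem_gapRingLE _)
  | succ j ih =>
    obtain ⟨p, hp, a, M, ha, hM, h⟩ := ih
    obtain ⟨hpR, hpn⟩ := mem_gapRingLE_iff.mp hp
    obtain ⟨ε, b, hb, hbM, h'⟩ := exists_signChanges_add_X_pow hpn ha hM
    refine ⟨_, mem_gapRingLE_iff.mpr ⟨add_mem hpR ?_, ?_⟩, b, M + 1, hb, hbM, by omega⟩
    · rw [← smul_eq_C_mul]
      exact (gapRing d).smul_mem (X_pow_mem_gapRing hd (by omega)) _
    · exact (natDegree_add_le _ _).trans (max_le (by omega)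
        ((natDegree_C_mul_X_pow_le _ _).trans (by omega)))

/-! ### Dual polynomials and the lower bound. -/

/-- Lagrange interpolation multiplied by `X ^ k`: the factor puts the product in `R`, but vanishes
at 0, hence the condition on `z`. -/
theorem exists_dual_of_ne_zero (hd : Finset.univ.gcd d = 1) {k : ℕ} (hk : conductor d ≤ k)
    {Z : Finset ℝ} (hZ : Z.card ≤ k) {z : ℝ} (hz0 : z ≠ 0) :
    ∃ e ∈ gapRingLE d (2 * k), e.eval z = 1 ∧ ∀ y ∈ Z, y ≠ z → e.eval y = 0 := by
  set q : ℝ[X] := ∏ y ∈ Z.erase z, (X - C y) with hq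
  have hqz : q.eval z ≠ 0 := by
    rw [hq, eval_prod]
    refine Finset.prod_ne_zero_iff.mpr fun y hy => ?_
    simpa [sub_eq_zero] using (Finset.ne_of_mem_erase hy).symm
  have hqdeg : q.natDegree ≤ k := by
    rw [hq, natDegree_prod_of_monic _ _ fun y _ => monic_X_sub_C y]
    simp only [natDegree_X_sub_C, Finset.sum_const, smul_eq_mul, mul_one]
    exact Finset.card_erase_le.trans hZ
  have hne : z ^ k * q.eval z ≠ 0 := mul_ne_zero (pow_ne_zero _ hz0) hqz
  refine ⟨(z ^ k * q.eval z)⁻¹ • (X ^ k * q), Submodule.smul_mem _ _ (mem_gapRingLE_iff.mpr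
    ⟨X_pow_mul_mem_gapRing hd hk q, ?_⟩), ?_, fun y hy hyz => ?_⟩
  · refine natDegree_mul_le.trans ?_
    rw [natDegree_X_pow]
    omega
  · simp only [eval_smul, eval_mul, eval_pow, eval_X, smul_eq_mul]
    exact inv_mul_cancel₀ hne
  · have : q.eval y = 0 := by
      rw [hq, eval_prod]
      exact Finset.prod_eq_zero (Finset.mem_erase.mpr ⟨hyz, hy⟩) (by simp)
    simp [this]

/-- Evaluations at up to `k` points are linearly independent on `R_{≤ 2k}`: there are dual
polynomials. -/
theorem exists_dual (hd : Finset.univ.gcd d = 1) {k : ℕ} (hk : conductor d ≤ k)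
    {Z : Finset ℝ} (hZ : Z.card ≤ k) {z : ℝ} (hz : z ∈ Z) :
    ∃ e ∈ gapRingLE d (2 * k), e.eval z = 1 ∧ ∀ y ∈ Z, y ≠ z → e.eval y = 0 := by
  by_cases hz0 : z = 0
  · subst hz0
    have key : ∀ y, ∃ e ∈ gapRingLE d (2 * k), y ∈ Z → y ≠ 0 →
        e.eval y = 1 ∧ ∀ x ∈ Z, x ≠ y → e.eval x = 0 := by
      intro y
      by_cases hy : y ∈ Z ∧ y ≠ 0
      · obtain ⟨e, he, h⟩ := exists_dual_of_ne_zero hd hk hZ hy.2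
        exact ⟨e, he, fun _ _ => h⟩
      · exact ⟨0, zero_mem _, fun h1 h2 => absurd ⟨h1, h2⟩ hy⟩
    choose e he h using key
    -- The constant 1 corrected by the duals of the nonzero points is dual to 0.
    refine ⟨1 - ∑ y ∈ Z.erase 0, e y, sub_mem (one_mem_gapRingLE _)
      (sum_mem fun y _ => he y), ?_, fun x hx hx0 => ?_⟩
    · rw [eval_sub, eval_one, eval_finsetSum, Finset.sum_eq_zero, sub_zero]
      intro y hy
      obtain ⟨hy0, hy⟩ := Finset.mem_erase.mp hy
      exact (h y hy hy0).2 0 hz hy0.symm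
    · rw [eval_sub, eval_one, eval_finsetSum,
        Finset.sum_eq_single_of_mem x (Finset.mem_erase.mpr ⟨hx0, hx⟩), (h x hx hx0).1, sub_self]
      intro y hy hyx
      obtain ⟨hy0, hy⟩ := Finset.mem_erase.mp hy
      exact (h y hy hy0).2 x hx hyx.symm
  · exact exists_dual_of_ne_zero hd hk hZ hz0

theorem pointEval_apply {V : Submodule ℝ ℝ[X]} (x : ℝ) (f : V) :
    pointEval V x f = (f : ℝ[X]).eval x := rfl

theorem isConicCombination_of_eq_sum {V : Submodule ℝ ℝ[X]} {L : V →ₗ[ℝ] ℝ} {Z : Finset ℝ}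
    {w : ℝ → ℝ} (hw : ∀ z ∈ Z, 0 ≤ w z) (hL : L = ∑ z ∈ Z, w z • pointEval V z) :
    IsConicCombination L Z.card := by
  refine ⟨fun i => (Z.equivFin.symm i : ℝ), fun i => w (Z.equivFin.symm i),
    fun i => hw _ (Z.equivFin.symm i).2, ?_⟩
  rw [hL, ← Finset.sum_coe_sort]
  exact (Equiv.sum_comp Z.equivFin.symm fun z : Z => w z • pointEval V z).symm

/-- A functional that is nonnegative on all polynomials nonnegative on a small set `Z` is a conic
combination of evaluations at points of `Z`. -/
theorem isConicCombination_of_nonneg_on (hd : Finset.univ.gcd d = 1) {k : ℕ}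
    (hk : conductor d ≤ k) {Z : Finset ℝ} (hZ : Z.card ≤ k)
    {L : gapRingLE d (2 * k) →ₗ[ℝ] ℝ}
    (hL : ∀ g : gapRingLE d (2 * k), (∀ z ∈ Z, 0 ≤ (g : ℝ[X]).eval z) → 0 ≤ L g) : IsConicCombination L Z.card := by
  have key : ∀ z, ∃ e : gapRingLE d (2 * k), z ∈ Z →
      (e : ℝ[X]).eval z = 1 ∧ ∀ y ∈ Z, y ≠ z → (e : ℝ[X]).eval y = 0 := by
    intro z
    by_cases hz : z ∈ Z
    · obtain ⟨e, he, h⟩ := exists_dual hd hk hZ hz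
      exact ⟨⟨e, he⟩, fun _ => h⟩
    · exact ⟨0, fun h => absurd h hz⟩
  choose e he using key
  refine isConicCombination_of_eq_sum (Z := Z) (w := fun z => L (e z))
    (fun z hz => hL _ fun y hy => ?_) ?_
  · by_cases hyz : y = z
    · rw [hyz, (he z hz).1]
      exact zero_le_one
    · rw [(he z hz).2 y hy hyz]
  · ext g
    -- The interpolation error vanishes on `Z`, so `L` is nonnegative on it and on its negative,
    -- hence zero.
    have hvan : ∀ z ∈ Z, ((g - ∑ y ∈ Z, (g : ℝ[X]).eval y • e y : gapRingLE d (2 * k)) :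
        ℝ[X]).eval z = 0 := by
      intro z hz
      simp only [Submodule.coe_sub, Submodule.coe_sum, Submodule.coe_smul, eval_sub,
        eval_finsetSum, eval_smul, smul_eq_mul]
      rw [Finset.sum_eq_single_of_mem z hz, (he z hz).1, mul_one, sub_self]
      intro y hy hyz
      rw [(he y hy).2 z hz hyz.symm, mul_zero]
    have h1 := hL _ fun z hz => (hvan z hz).ge
    have h2 := hL (-(g - ∑ y ∈ Z, (g : ℝ[X]).eval y • e y)) fun z hz => by
      rw [Submodule.coe_neg, eval_neg, hvan z hz, neg_zero]
    rw [map_neg] at h2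
    have h3 : L (g - ∑ y ∈ Z, (g : ℝ[X]).eval y • e y) = 0 := by linarith
    rw [map_sub, map_sum, sub_eq_zero] at h3
    rw [h3, LinearMap.sum_apply]
    refine Finset.sum_congr rfl fun z _ => ?_
    rw [map_smul, LinearMap.smul_apply, pointEval_apply, smul_eq_mul, smul_eq_mul, mul_comm]

theorem IsConicCombination.add_smul_pointEval {V : Submodule ℝ ℝ[X]} {L : V →ₗ[ℝ] ℝ} {n : ℕ}
    (hL : IsConicCombination L n) {s : ℝ} (hs : 0 ≤ s) (x : ℝ) :
    IsConicCombination (L + s • pointEval V x) (n + 1) := by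
  obtain ⟨y, a, ha, rfl⟩ := hL
  refine ⟨Fin.snoc y x, Fin.snoc a s, fun i => ?_, ?_⟩
  · refine Fin.lastCases ?_ (fun i => ?_) i
    · simpa using hs
    · simpa using ha i
  · simp [Fin.sum_univ_castSucc]

theorem exists_lower_bound (hd : Finset.univ.gcd d = 1) {k : ℕ} (hk : conductor d ≤ k) :
    ∃ L : gapRingLE d (2 * k) →ₗ[ℝ] ℝ, IsMomentFunctional L ∧
      ∀ n, IsConicCombination L n →
        descartesNumber d (conductor d) + (k - conductor d) ≤ n := by
  obtain ⟨p, hp, hp0, hcard⟩ := exists_card_roots_ge hd hk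
  obtain ⟨hpR, hpn⟩ := mem_gapRingLE_iff.mp hp
  set Z := p.roots.toFinset with hZdef
  have hZ : Z.card ≤ k := (Multiset.toFinset_card_le _).trans ((card_roots' p).trans hpn)
  have hroot : ∀ z, z ∈ Z ↔ p.eval z = 0 := fun z => by
    rw [hZdef, Multiset.mem_toFinset, mem_roots hp0, IsRoot.def]
  refine ⟨∑ z ∈ Z, pointEval _ z, ⟨∑ z ∈ Z, Measure.dirac z, fun f => ?_⟩, fun n hn => ?_⟩
  · have hinteg : ∀ z ∈ Z, Integrable (fun x : ℝ => (f : ℝ[X]).eval x) (Measure.dirac z) :=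
      fun z _ => integrable_dirac (by simp)
    refine ⟨integrable_finsetSum_measure.mpr hinteg, ?_⟩
    rw [integral_finsetSum_measure hinteg, LinearMap.sum_apply]
    exact Finset.sum_congr rfl fun z _ => by rw [integral_dirac, pointEval_apply]
  · obtain ⟨x, a, ha, hL⟩ := hn
    refine hcard.trans ?_
    have happ : ∀ f : gapRingLE d (2 * k), ∑ z ∈ Z, (f : ℝ[X]).eval z =
        ∑ i, a i * (f : ℝ[X]).eval (x i) := by
      intro f
      have := LinearMap.congr_fun hL f
      simpa [LinearMap.sum_apply, pointEval_apply] using this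
    have hsq : p ^ 2 ∈ gapRingLE d (2 * k) :=
      mem_gapRingLE_iff.mpr ⟨pow_mem hpR 2, natDegree_pow_le.trans (by omega)⟩
    have h0 := happ ⟨p ^ 2, hsq⟩
    rw [Finset.sum_eq_zero fun z hz => by simp [(hroot z).mp hz]] at h0
    have h1 := (Finset.sum_eq_zero_iff_of_nonneg fun i _ => by
      simpa using mul_nonneg (ha i) (sq_nonneg (p.eval (x i)))).mp h0.symm
    have hsub : Z ⊆ Finset.univ.image x := by
      intro z hz
      obtain ⟨e, he, hez, hey⟩ := exists_dual hd hk hZ hz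
      have h2 := happ ⟨e, he⟩
      rw [Finset.sum_eq_single_of_mem z hz fun y hy hyz => hey y hy hyz] at h2
      change e.eval z = _ at h2
      rw [hez] at h2
      obtain ⟨i, -, hi⟩ := Finset.exists_ne_zero_of_sum_ne_zero
        (h2.symm.trans_ne one_ne_zero)
      have h3 := h1 i (Finset.mem_univ i)
      simp only [eval_pow, mul_eq_zero, left_ne_zero_of_mul hi, false_or, ne_eq,
        OfNat.ofNat_ne_zero, not_false_eq_true, pow_eq_zero_iff] at h3
      have h4 : x i = z := by
        by_contra h4
        exact right_ne_zero_of_mul hi (hey _ ((hroot _).mpr h3) h4)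
      exact Finset.mem_image.mpr ⟨i, Finset.mem_univ i, h4⟩
    simpa using (Finset.card_le_card hsub).trans Finset.card_image_le

/-! ### Nonnegative polynomials and the upper bound. -/

/-- The zeros of a nonnegative polynomial in `R_{≤ 2k}`. -/
theorem card_roots_le_of_nonneg {k : ℕ} (hk : conductor d ≤ k) {f : ℝ[X]}
    (hf : f ∈ gapRingLE d (2 * k)) (h0 : f ≠ 0) (hpos : ∀ x, 0 ≤ f.eval x) :
    f.roots.toFinset.card ≤ k ∧ 2 * f.roots.toFinset.card ≤
      descartesNumber d (conductor d) + (2 * k - conductor d) + 1 := by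
  obtain ⟨ε, hne, hle⟩ := two_mul_card_roots_le h0 hpos
  have hmem : f + C ε ∈ gapRingLE d (2 * k) := by
    refine add_mem hf ?_
    rw [← mul_one (C ε), ← smul_eq_C_mul]
    exact Submodule.smul_mem _ _ (one_mem_gapRingLE _)
  have h1 := card_roots_le_descartesNumber_add (c := conductor d) (by omega) hmem hne
  have h2 := (Multiset.toFinset_card_le _).trans
    ((card_roots' (f + C ε)).trans (mem_gapRingLE_iff.mp hmem).2)
  omega

/-- A nonnegative `f` with zero integral vanishes almost everywhere, so only the values of a
polynomial at the zeros of `f` affect its integral. -/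
theorem isConicCombination_of_integral_eq_zero (hd : Finset.univ.gcd d = 1) {k : ℕ}
    (hk : conductor d ≤ k) {L : gapRingLE d (2 * k) →ₗ[ℝ] ℝ} (hL : IsMomentFunctional L)
    {f : gapRingLE d (2 * k)} (hf : (f : ℝ[X]) ≠ 0) (hpos : ∀ x, 0 ≤ (f : ℝ[X]).eval x)
    (hLf : L f = 0) : IsConicCombination L (f : ℝ[X]).roots.toFinset.card := by
  obtain ⟨μ, hμ⟩ := hL
  refine isConicCombination_of_nonneg_on hd hk (card_roots_le_of_nonneg hk f.2 hf hpos).1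
    fun g hg => ?_
  rw [(hμ f).2, integral_eq_zero_iff_of_nonneg hpos (hμ f).1] at hLf
  rw [(hμ g).2]
  refine integral_nonneg_of_ae (hLf.mono fun x hx => hg x ?_)
  rw [Multiset.mem_toFinset, mem_roots hf]
  exact hx

/-- Among the nonnegative elements of a finite-dimensional space of functions there is one that
maximizes the quotient of `|ℓ|` and a strictly positive functional `L`. -/
theorem exists_maximizer {V ι : Type*} [AddCommGroup V] [Module ℝ V] [FiniteDimensional ℝ V]
    (ev : ι → V →ₗ[ℝ] ℝ) (L ℓ : V →ₗ[ℝ] ℝ)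
    (hL : ∀ f, f ≠ 0 → (∀ t, 0 ≤ ev t f) → 0 < L f) (hne : ∃ f, f ≠ 0 ∧ ∀ t, 0 ≤ ev t f) :
    ∃ f, f ≠ 0 ∧ (∀ t, 0 ≤ ev t f) ∧ ∀ g, (∀ t, 0 ≤ ev t g) → |ℓ g| * L f ≤ |ℓ f| * L g := by
  let φ : V ≃ₗ[ℝ] (Fin (Module.finrank ℝ V) → ℝ) := (Module.finBasis ℝ V).equivFun
  have hcont : ∀ m : V →ₗ[ℝ] ℝ, Continuous fun v => m (φ.symm v) := fun m =>
    (m.comp φ.symm.toLinearMap).continuous_of_finiteDimensional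
  -- The quotient is homogeneous of degree 0, so it suffices to maximize it on the compact unit
  -- slice of the cone, where `L` is positive.
  set B := Metric.sphere (0 : Fin (Module.finrank ℝ V) → ℝ) 1 ∩ {v | ∀ t, 0 ≤ ev t (φ.symm v)}
    with hB
  have hBc : IsCompact B := (isCompact_sphere _ _).inter_right <| by
    rw [Set.ofPred_forall]
    exact isClosed_iInter fun t => isClosed_le continuous_const (hcont (ev t))
  have hnorm : ∀ g, g ≠ 0 → (∀ t, 0 ≤ ev t g) → ‖φ g‖⁻¹ • φ g ∈ B := by
    intro g hg hpos
    have h0 : φ g ≠ 0 := fun h => hg (φ.map_eq_zero_iff.mp h)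
    refine ⟨by simp [norm_smul, h0], fun t => ?_⟩
    rw [map_smul, LinearEquiv.symm_apply_apply, map_smul, smul_eq_mul]
    exact mul_nonneg (inv_nonneg.mpr (norm_nonneg _)) (hpos t)
  have hB0 : ∀ v ∈ B, φ.symm v ≠ 0 := by
    intro v hv h
    have h1 : v = 0 := φ.symm.map_eq_zero_iff.mp h
    have h2 := hv.1
    simp [h1] at h2
  have hpos : ∀ v ∈ B, 0 < L (φ.symm v) := fun v hv => hL _ (hB0 v hv) hv.2
  obtain ⟨f₀, hf₀, hf₀'⟩ := hne
  obtain ⟨v, hv, hmax⟩ := hBc.exists_isMaxOn ⟨_, hnorm f₀ hf₀ hf₀'⟩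
    (f := fun v => |ℓ (φ.symm v)| / L (φ.symm v))
    ((hcont ℓ).abs.continuousOn.div (hcont L).continuousOn fun v hv => (hpos v hv).ne')
  refine ⟨φ.symm v, hB0 v hv, hv.2, fun g hg => ?_⟩
  by_cases hg0 : g = 0
  · simp [hg0]
  have h1 := hmax (hnorm g hg0 hg)
  have h0 : 0 < ‖φ g‖ := norm_pos_iff.mpr fun h => hg0 (φ.map_eq_zero_iff.mp h)
  simp only [Set.mem_ofPred_eq, map_smul, LinearEquiv.symm_apply_apply, smul_eq_mul, abs_mul,
    abs_inv, abs_norm] at h1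
  rw [mul_div_mul_left _ _ (inv_ne_zero h0.ne'),
    div_le_div_iff₀ (hL g hg0 hg) (hpos v hv)] at h1
  exact h1

/-- Having `|x|` on the left avoids the exponent `n - 1`. -/
theorem abs_mul_abs_eval_le {p : ℝ[X]} {n : ℕ} (hp : ∀ i, n ≤ i → p.coeff i = 0) {x : ℝ}
    (hx : 1 ≤ |x|) : |x| * |p.eval x| ≤ |x| ^ n * ∑ i ∈ Finset.range n, |p.coeff i| := by
  have h : p.eval x = ∑ i ∈ Finset.range n, p.coeff i * x ^ i := by
    rw [eval_eq_sum_range' (n := n + (p.natDegree + 1)) (by omega), Finset.sum_range_add,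
      Finset.sum_eq_zero (s := Finset.range (p.natDegree + 1)), add_zero]
    intro i _
    rw [hp _ (by omega), zero_mul]
  rw [h, Finset.mul_sum]
  refine (mul_le_mul_of_nonneg_left (Finset.abs_sum_le_sum_abs _ _) (abs_nonneg x)).trans ?_
  rw [Finset.mul_sum]
  refine Finset.sum_le_sum fun i hi => ?_
  rw [abs_mul, abs_pow, mul_left_comm, ← pow_succ', mul_comm]
  exact mul_le_mul_of_nonneg_right (pow_le_pow_right₀ hx (Finset.mem_range.mp hi)) (abs_nonneg _)

/-- If `g` is nonnegative at the zeros of the nonnegative polynomial `f` of degree `2k`, then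
`g + δ + C f` is nonnegative for a large constant `C`. -/
theorem exists_nonneg_add_mul {f g : ℝ[X]} {k : ℕ} (hf : f.natDegree ≤ 2 * k)
    (hlead : f.coeff (2 * k) ≠ 0) (hpos : ∀ x, 0 ≤ f.eval x) (hg : g.natDegree ≤ 2 * k)
    (hgf : ∀ x, f.eval x = 0 → 0 ≤ g.eval x) {δ : ℝ} (hδ : 0 < δ) :
    ∃ c, ∀ x, 0 ≤ g.eval x + δ + c * f.eval x := by
  set b := f.coeff (2 * k) with hb
  set f₁ := f - C b * X ^ (2 * k) with hf₁
  have hf₁c : ∀ i, 2 * k ≤ i → f₁.coeff i = 0 := by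
    intro i hi
    rw [hf₁, coeff_sub, coeff_C_mul, coeff_X_pow]
    rcases hi.eq_or_lt with rfl | hi
    · simp [hb]
    · rw [coeff_eq_zero_of_natDegree_lt (by omega), if_neg (by omega), mul_zero, sub_zero]
  set S := ∑ i ∈ Finset.range (2 * k), |f₁.coeff i| with hS
  set G := ∑ i ∈ Finset.range (2 * k + 1), |g.coeff i| with hG
  have hS0 : 0 ≤ S := Finset.sum_nonneg fun _ _ => abs_nonneg _
  have hG0 : 0 ≤ G := Finset.sum_nonneg fun _ _ => abs_nonneg _
  have hfx : ∀ x, f.eval x = f₁.eval x + b * x ^ (2 * k) := fun x => by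
    simp [hf₁]
  have hfar : ∀ x : ℝ, 1 ≤ |x| → |x| * |f₁.eval x| ≤ x ^ (2 * k) * S := fun x hx => by
    have := abs_mul_abs_eval_le hf₁c hx
    rwa [(even_two_mul k).pow_abs] at this
  have hgfar : ∀ x : ℝ, 1 ≤ |x| → |g.eval x| ≤ x ^ (2 * k) * G := fun x hx => by
    have := abs_mul_abs_eval_le (p := g) (n := 2 * k + 1)
      (fun i hi => coeff_eq_zero_of_natDegree_lt (by omega)) hx
    rw [pow_succ', (even_two_mul k).pow_abs, mul_assoc] at this
    exact le_of_mul_le_mul_left this (by linarith)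
  have hb0 : 0 < b := by
    refine lt_of_le_of_ne ?_ hlead.symm
    by_contra hneg
    have hneg := not_le.mp hneg
    set x := 1 + 2 * S / -b with hx
    have hx1 : 1 ≤ x := by
      have : 0 ≤ 2 * S / -b := div_nonneg (by linarith) (by linarith)
      linarith
    have habs : |x| = x := abs_of_pos (by linarith)
    have h1 := hfar x (by rwa [habs])
    rw [habs] at h1
    have h2 := hpos x
    rw [hfx] at h2
    have h3 : 0 < x ^ (2 * k) := by positivity
    have h4 : x * -b = -b + 2 * S := by
      have : 2 * S / -b * -b = 2 * S := div_mul_cancel₀ _ (by linarith)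
      rw [hx, add_mul, this, one_mul]
    have h5 := le_abs_self (f₁.eval x)
    have h6 : x * -b * x ^ (2 * k) ≤ x ^ (2 * k) * S := by nlinarith
    rw [h4] at h6
    nlinarith
  -- Beyond `T` the leading term dominates: `f` is at least half of it.
  set T := 1 + 2 * S / b with hT
  have hT1 : 1 ≤ T := by
    have : 0 ≤ 2 * S / b := by positivity
    linarith
  have hlow : ∀ x, T ≤ |x| → b * x ^ (2 * k) ≤ 2 * f.eval x := by
    intro x hx
    have h1 := hfar x (hT1.trans hx)
    have h3 : 0 ≤ x ^ (2 * k) := (even_two_mul k).pow_nonneg x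
    have h4 : 2 * S ≤ |x| * b := by
      have : T * b = b + 2 * S := by rw [hT]; field_simp
      nlinarith
    have h5 := neg_abs_le (f₁.eval x)
    have h6 : |x| * (2 * |f₁.eval x|) ≤ |x| * (b * x ^ (2 * k)) := by nlinarith
    have h7 := le_of_mul_le_mul_left h6 (by linarith)
    rw [hfx]
    linarith
  have hK : IsCompact (Set.Icc (-T) T ∩ {x | g.eval x + δ ≤ 0}) :=
    isCompact_Icc.inter_right (isClosed_le (by fun_prop) continuous_const)
  have hfK : ∀ x ∈ Set.Icc (-T) T ∩ {x | g.eval x + δ ≤ 0}, f.eval x ≠ 0 := by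
    intro x hx h
    have h1 := hgf x h
    have h2 : g.eval x + δ ≤ 0 := hx.2
    linarith
  obtain ⟨c, hc⟩ := hK.exists_bound_of_continuousOn (f := fun x => (g.eval x + δ) / f.eval x)
    (ContinuousOn.div (by fun_prop) (by fun_prop) hfK)
  -- `2 * G / b` controls the tails and `|c|` the compact set where `g + δ ≤ 0`. On that set `f` has
  -- no zero, thanks to `δ > 0`.
  refine ⟨|c| + 2 * G / b, fun x => ?_⟩
  have hGb : 0 ≤ 2 * G / b := by positivity
  have hfx0 := hpos x
  by_cases hxT : T ≤ |x|
  · have h1 := hgfar x (hT1.trans hxT)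
    have h2 := hlow x hxT
    have h3 : G * x ^ (2 * k) ≤ 2 * G / b * f.eval x := by
      rw [div_mul_eq_mul_div, le_div_iff₀ hb0]
      nlinarith
    have h4 := neg_abs_le (g.eval x)
    have h5 := mul_nonneg (abs_nonneg c) hfx0
    nlinarith
  · by_cases hgx : g.eval x + δ ≤ 0
    · have hxK : x ∈ Set.Icc (-T) T ∩ {x | g.eval x + δ ≤ 0} :=
        ⟨abs_le.mp (not_le.mp hxT).le, hgx⟩
      have h1 := hc x hxK
      have hf0 : 0 < f.eval x := hfx0.lt_of_ne' (hfK x hxK)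
      rw [Real.norm_eq_abs, abs_div, abs_of_pos hf0, div_le_iff₀ hf0] at h1
      have h2 := neg_abs_le (g.eval x + δ)
      have h3 := mul_le_mul_of_nonneg_right (le_abs_self c) hfx0
      nlinarith [mul_nonneg hGb hfx0]
    · have : 0 ≤ (|c| + 2 * G / b) * f.eval x := by positivity
      linarith

theorem finiteDimensional_gapRingLE (n : ℕ) : FiniteDimensional ℝ (gapRingLE d n) := by
  have : FiniteDimensional ℝ (degreeLE ℝ (n : WithBot ℕ)) := by
    rw [degreeLE_eq_span_X_pow]
    exact FiniteDimensional.span_finset ℝ _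
  exact Submodule.finiteDimensional_of_le inf_le_right

theorem exists_le_isConicCombination (hd : Finset.univ.gcd d = 1) {k : ℕ}
    (hk : conductor d ≤ k) {L : gapRingLE d (2 * k) →ₗ[ℝ] ℝ} (hL : IsMomentFunctional L) :
    ∃ n, IsConicCombination L n ∧
      2 * n ≤ descartesNumber d (conductor d) + (2 * k - conductor d) + 3 := by
  by_cases hdeg : ∃ f : gapRingLE d (2 * k), (f : ℝ[X]) ≠ 0 ∧
      (∀ x, 0 ≤ (f : ℝ[X]).eval x) ∧ L f = 0
  · obtain ⟨f, hf, hpos, hLf⟩ := hdeg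
    refine ⟨_, isConicCombination_of_integral_eq_zero hd hk hL hf hpos hLf, ?_⟩
    have := (card_roots_le_of_nonneg hk f.2 hf hpos).2
    omega
  have hnonneg : ∀ f : gapRingLE d (2 * k), (∀ x, 0 ≤ (f : ℝ[X]).eval x) → 0 ≤ L f := by
    obtain ⟨μ, hμ⟩ := hL
    intro f hf
    rw [(hμ f).2]
    exact integral_nonneg hf
  have hLpos : ∀ f : gapRingLE d (2 * k), f ≠ 0 →
      (∀ x, 0 ≤ pointEval (gapRingLE d (2 * k)) x f) → 0 < L f := fun f hf hpos =>
    (hnonneg f hpos).lt_of_ne' fun h => hdeg ⟨f, fun h' => hf (Subtype.ext h'), hpos, h⟩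
  have := finiteDimensional_gapRingLE (d := d) (2 * k)
  let M : gapRingLE d (2 * k) :=
    ⟨X ^ (2 * k), mem_gapRingLE_iff.mpr ⟨X_pow_mem_gapRing hd (by omega), by simp⟩⟩
  have hMx : ∀ x, (M : ℝ[X]).eval x = x ^ (2 * k) := fun x => by simp [M]
  have hMpos : ∀ x, 0 ≤ pointEval (gapRingLE d (2 * k)) x M := fun x => by
    rw [pointEval_apply, hMx]
    exact (even_two_mul k).pow_nonneg x
  have hM0 : M ≠ 0 := fun h => pow_ne_zero (2 * k) X_ne_zero (congrArg Subtype.val h)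
  have hne : ∃ f : gapRingLE d (2 * k), f ≠ 0 ∧
      ∀ x, 0 ≤ pointEval (gapRingLE d (2 * k)) x f := ⟨M, hM0, hMpos⟩
  -- On the nonnegative cone the strictly positive `L` controls every coefficient.
  have hcoeff : ∀ i, ∃ c, ∀ f : gapRingLE d (2 * k), (∀ x, 0 ≤ (f : ℝ[X]).eval x) →
      |(f : ℝ[X]).coeff i| ≤ c * L f := by
    intro i
    obtain ⟨f, hf0, hf, hmax⟩ := exists_maximizer (pointEval (gapRingLE d (2 * k))) L
      ((lcoeff ℝ i).comp (gapRingLE d (2 * k)).subtype) hLpos hne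
    refine ⟨|(f : ℝ[X]).coeff i| / L f, fun g hg => ?_⟩
    rw [div_mul_eq_mul_div, le_div_iff₀ (hLpos f hf0 hf)]
    exact hmax g hg
  choose c hc using hcoeff
  -- For an `x` this large, a polynomial of degree below 2k cannot match the quotient `M(x) / L M`
  -- of `M = X ^ (2 * k)`, so the maximizer has degree 2k.
  set x := |(∑ i ∈ Finset.range (2 * k), c i) * L M| + 1 with hx
  have hx1 : 1 ≤ x := by
    have := abs_nonneg ((∑ i ∈ Finset.range (2 * k), c i) * L M)
    linarith
  obtain ⟨f, hf0, hf, hmax⟩ := exists_maximizer (pointEval (gapRingLE d (2 * k))) L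
    (pointEval _ x) hLpos hne
  have hLf := hLpos f hf0 hf
  have hLM := hLpos M hM0 hMpos
  have hxk : 0 < x ^ (2 * k) := by positivity
  have hmaxM := hmax M hMpos
  rw [pointEval_apply, hMx, abs_of_pos hxk, abs_of_nonneg (hf x), pointEval_apply] at hmaxM
  have hfx : 0 < (f : ℝ[X]).eval x :=
    pos_of_mul_pos_left ((mul_pos hxk hLf).trans_le hmaxM) hLM.le
  have hf0' : (f : ℝ[X]) ≠ 0 := fun h => hf0 (Subtype.ext h)
  have hfdeg := (mem_gapRingLE_iff.mp f.2).2
  have hlead : (f : ℝ[X]).coeff (2 * k) ≠ 0 := by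
    intro h0
    have hvan : ∀ i, 2 * k ≤ i → (f : ℝ[X]).coeff i = 0 := by
      intro i hi
      rcases hi.eq_or_lt with rfl | hi
      · exact h0
      · exact coeff_eq_zero_of_natDegree_lt (by omega)
    have h1 := abs_mul_abs_eval_le hvan (x := x) (hx1.trans (le_abs_self x))
    rw [abs_of_pos (by linarith : 0 < x), abs_of_pos hfx] at h1
    have h2 : ∑ i ∈ Finset.range (2 * k), |(f : ℝ[X]).coeff i| ≤
        (∑ i ∈ Finset.range (2 * k), c i) * L f := by
      rw [Finset.sum_mul]
      exact Finset.sum_le_sum fun i _ => hc i f hf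
    have h3 : x * (x ^ (2 * k) * L f) ≤
        (∑ i ∈ Finset.range (2 * k), c i) * L M * (x ^ (2 * k) * L f) :=
      calc x * (x ^ (2 * k) * L f) ≤ x * ((f : ℝ[X]).eval x * L M) :=
            mul_le_mul_of_nonneg_left hmaxM (by linarith)
        _ = x * (f : ℝ[X]).eval x * L M := by ring
        _ ≤ x ^ (2 * k) * ((∑ i ∈ Finset.range (2 * k), c i) * L f) * L M :=
            mul_le_mul_of_nonneg_right
              (h1.trans (mul_le_mul_of_nonneg_left h2 hxk.le)) hLM.le
        _ = _ := by ring
    have h4 := le_of_mul_le_mul_right h3 (mul_pos hxk hLf)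
    have h5 := le_abs_self ((∑ i ∈ Finset.range (2 * k), c i) * L M)
    linarith
  -- The largest mass at `x` that can be removed while staying nonnegative on the cone.
  set s := L f / (f : ℝ[X]).eval x with hs
  have hs0 : 0 ≤ s := div_nonneg hLf.le hfx.le
  set L' := L - s • pointEval (gapRingLE d (2 * k)) x with hL'
  have hL'app : ∀ g, L' g = L g - s * (g : ℝ[X]).eval x := fun g => rfl
  have hL'f : L' f = 0 := by
    rw [hL'app, hs, div_mul_cancel₀ _ hfx.ne', sub_self]
  have hL'pos : ∀ g : gapRingLE d (2 * k), (∀ x, 0 ≤ (g : ℝ[X]).eval x) → 0 ≤ L' g := by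
    intro g hg
    have h1 := hmax g hg
    rw [pointEval_apply, pointEval_apply, abs_of_nonneg (hg x), abs_of_pos hfx] at h1
    rw [hL'app, hs, sub_nonneg, div_mul_eq_mul_div, div_le_iff₀ hfx]
    linarith
  obtain ⟨hZk, hZ⟩ := card_roots_le_of_nonneg hk f.2 hf0' hf
  have hconic : IsConicCombination L' (f : ℝ[X]).roots.toFinset.card := by
    refine isConicCombination_of_nonneg_on hd hk hZk fun g hg => ?_
    let u : gapRingLE d (2 * k) := ⟨1, one_mem_gapRingLE _⟩
    have hu : 0 ≤ L' u := hL'pos u fun y => by simp [u]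
    -- The `δ` below makes `δ * L' u ≤ η`; the `+ 1` in its denominator covers `L' u = 0`.
    refine le_of_forall_pos_le_add fun η hη => ?_
    obtain ⟨b, hb⟩ := exists_nonneg_add_mul hfdeg hlead hf (mem_gapRingLE_iff.mp g.2).2
      (fun y hy => hg y (by rwa [Multiset.mem_toFinset, mem_roots hf0', IsRoot.def]))
      (δ := η / (L' u + 1)) (by positivity)
    have h1 := hL'pos (g + (η / (L' u + 1)) • u + b • f) fun y => by
      simpa [u] using hb y
    rw [map_add, map_add, map_smul, map_smul, hL'f, smul_zero, add_zero, smul_eq_mul] at h1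
    have h2 : η / (L' u + 1) * L' u ≤ η := by
      rw [div_mul_eq_mul_div, div_le_iff₀ (by positivity)]
      nlinarith
    linarith
  refine ⟨_, ?_, show 2 * ((f : ℝ[X]).roots.toFinset.card + 1) ≤ _ by omega⟩
  have := hconic.add_smul_pointEval hs0 x
  rwa [hL', sub_add_cancel] at this

end SparseMoment

end

theorem mainTheorem9 {r : ℕ} (d : Fin r → ℕ) (hd : Finset.univ.gcd d = 1)
    (k : ℕ) (hk : SparseMoment.conductor d ≤ k) :
    (∀ L : SparseMoment.gapRingLE d (2 * k) →ₗ[ℝ] ℝ, SparseMoment.IsMomentFunctional L →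
      ∃ n : ℕ,
        (n : ℤ) ≤ (k : ℤ) + 1 -
          ⌈((SparseMoment.conductor d : ℚ) -
            (SparseMoment.descartesNumber d (SparseMoment.conductor d) : ℚ) - 1) / 2⌉ ∧
        SparseMoment.IsConicCombination L n) ∧
    (∃ L : SparseMoment.gapRingLE d (2 * k) →ₗ[ℝ] ℝ, SparseMoment.IsMomentFunctional L ∧
      ∀ n : ℕ, SparseMoment.IsConicCombination L n →
        (k : ℤ) - ((SparseMoment.conductor d : ℤ) -
          (SparseMoment.descartesNumber d (SparseMoment.conductor d) : ℤ)) ≤ (n : ℤ)) := by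
  have hk2 : SparseMoment.conductor d ≤ 2 * k := by omega
  refine ⟨fun L hL => ?_, ?_⟩
  · obtain ⟨n, hn, hle⟩ := SparseMoment.exists_le_isConicCombination hd hk hL
    refine ⟨n, ?_, hn⟩
    -- Since `n` is an integer, the rounding comes for free from the unrounded inequality.
    rw [le_sub_comm, Int.ceil_le]
    have h : 2 * (n : ℚ) ≤ (SparseMoment.descartesNumber d (SparseMoment.conductor d) : ℚ) +
        (2 * k - SparseMoment.conductor d) + 3 := by
      have h' : ((2 * n : ℕ) : ℚ) ≤ ((SparseMoment.descartesNumber d (SparseMoment.conductor d) +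
        (2 * k - SparseMoment.conductor d) + 3 : ℕ) : ℚ) := by exact_mod_cast hle
      push_cast [Nat.cast_sub hk2] at h'
      exact h'
    push_cast
    linarith
  · obtain ⟨L, hL, h⟩ := SparseMoment.exists_lower_bound hd hk
    refine ⟨L, hL, fun n hn => ?_⟩
    have := h n hn
    omega
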